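/- Let $0<q<n$ be coprime integers and let $n/q=[k_1,\dots,k_s]=k_1-1/(k_2-1/(\cdots-1/k_s))$, all $k_v\ge 2$, be the Hirzebruch–Jung continued fraction. Let $(X,o)=(\mathbb{C}^2,0)/\mathbb{Z}_n$ be the cyclic quotient singularity for the action $\xi*(z_1,z_2)=(\xi z_1,\xi^q z_2)$. Realize its minimal resolution $\pi:\widetilde X\to X$ as the union of charts $U_0,\dots,U_s\cong\mathbb{C}^2$ with coordinates $(\alpha_v,\beta_v)$, where for $1\le v\le s$ the sets $\{\alpha_{v-1}\ne0\}\subset U_{v-1}$ and $\{\beta_v\neq 0\}\subset U_v$ are glued by $\beta_v=\alpha_{v-1}^{-1}$, $\alpha_v=\alpha_{v-1}^{k_v}\beta_{v-1}$. The exceptional curve $E_v$ ($1\le v\le s$) is $\{\beta_{v-1}=0\}$ in $U_{v-1}$ and $\{\alpha_v=0\}$ in $U_v$, with $E_v^2=-k_v$; the dual graph is the string $E_1,\dots,E_s$, and $\mathrm{val}_v$ is the number of neighbours of $E_v$ in it. Let $g_0,\dots,g_{t+1}$ be the minimal set of invariant monomials generating $\mathbb{C}[z_1,z_2]^{\mathbb{Z}_n}$,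 that is, the monomials $z_1^Nz_2^M\ne 1$ with $N+qM\equiv 0 \pmod n$ which are not products of two nonconstant invariant monomials. For $g_j=z_1^Nz_2^M$ put $m_0^j=M$, $m_1^j=(N+qM)/n$ and $m^j_{v+1}=k_vm^j_v-m^j_{v-1}$ for $1\le v\le s$. Let $\Psi:\widetilde X\to\mathbb{C}^{t+2}$ be the map which in $U_v$ is given by $(\alpha_v^{m^j_v}\beta_v^{m^j_{v+1}})_{j}$, i.e. $\Psi=(\pi^*g_0,\dots,\pi^*g_{t+1})$; it contracts $\bigcup_v E_v$ to the origin and identifies $(X,o)$ with its image germ in $(\mathbb{C}^{t+2},0)$. For each $v$ let $r_v\ge 0$ and choose $r_v$ parametrized germs of holomorphic discs $\gamma_{v,i}:(\mathbb{C},0)\to\widetilde X$ ($1\le i\le r_v$) which meet $E_v$ transversally at pairwise different points $\gamma_{v,i}(0)\in E_v\setminus\bigcup_{w\ne v}E_w$. Suppose that for all $1\le v_1\le v_2\le s$ $$\sum_{v_1\le v\le v_2} r_v\ \le\ 1+\sum_{v_1\le v\le v_2}(k_v-\mathrm{val}_v).$$ Then the tangent vectors $(\Psi\circ\gamma_{v,i})'(0)\in\mathbb{C}^{t+2}$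 ($1\le v\le s$, $1\le i\le r_v$) are linearly independent, and the germ at the origin of the union of the images under $\Psi$ of the discs is an ordinary $(\sum_v r_v)$-tuple, i.e. for $r=\sum_v r_v$ it is analytically isomorphic to the germ at $0$ of the union of the coordinate axes of $\mathbb{C}^r$. (Here the union of the coordinate axes of $\mathbb{C}^0$ is taken to be empty.) -/

import Mathlib

open Filter Topology

noncomputable section

namespace CyclicQuotient

/-! ### Combinatorial data -/

/-- The value `[k₁, …, kₛ] = k₁ - 1/(k₂ - 1/(… - 1/kₛ))` of a Hirzebruch–Jung continued fraction.
When all entries are at least `2` (the only case used) no division by zero occurs: `1/0 = 0` is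
used only to read `[k₁]` as `k₁ - 1/[] = k₁`. -/
def hjValue : List ℕ → ℚ
  | [] => 0
  | k :: l => (k : ℚ) - 1 / hjValue l

/-- The valency of the vertex `v` in a string (path graph) with `s` vertices. -/
def valency {s : ℕ} (v : Fin s) : ℕ :=
  (Finset.univ.filter fun w : Fin s => w.val + 1 = v.val ∨ v.val + 1 = w.val).card

/-- The pair `(N, M)` is the exponent of a monomial `z₁ ^ N * z₂ ^ M` which is invariant under
`ξ * (z₁, z₂) = (ξ z₁, ξ ^ q z₂)`, `ξ ^ n = 1`. -/
def IsInvariant (n q : ℕ) (p : ℕ × ℕ) : Prop := n ∣ p.1 + q * p.2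

/-- The exponent of a member of the minimal system of monomial generators of the ring of
invariants: a nonzero invariant exponent which is not a sum of two nonzero invariant exponents. -/
def IsMinimalGenerator (n q : ℕ) (p : ℕ × ℕ) : Prop :=
  IsInvariant n q p ∧ p ≠ 0 ∧
    ∀ a b : ℕ × ℕ, IsInvariant n q a → IsInvariant n q b → p = a + b → a = 0 ∨ b = 0

open Classical in
/-- The finite set of exponents of the minimal monomial generators `g₀, …, g_{t+1}`
(see `mem_generators`). -/
def generators (n q : ℕ) : Finset (ℕ × ℕ) :=
  (Finset.range (n + 1) ×ˢ Finset.range (n + 1)).filter (IsMinimalGenerator n q)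

theorem mem_generators {n q : ℕ} (hn : 0 < n) (p : ℕ × ℕ) :
    p ∈ generators n q ↔ IsMinimalGenerator n q p := by
  classical
  simp only [generators, Finset.mem_filter, Finset.mem_product, Finset.mem_range,
    and_iff_right_iff_imp]
  rintro ⟨hp, -, hmin⟩
  obtain ⟨N, M⟩ := p
  simp only [IsInvariant] at hp hmin
  constructor
  · by_contra! h
    rcases hmin (n, 0) (N - n, M) (by simp)
      (by
        have h1 : N + q * M = n + ((N - n) + q * M) := by dsimp only at h; omega
        rw [h1] at hp
        exact (Nat.dvd_add_right (dvd_refl n)).1 hp)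
      (by dsimp only at h; ext <;> simp; omega) with h0 | h0
    · simp at h0; omega
    · simp at h0 h; omega
  · by_contra! h
    rcases hmin (0, n) (N, M - n) (by simp)
      (by
        have h1 : N + q * M = q * n + (N + q * (M - n)) := by
          dsimp only at h
          obtain ⟨d, rfl⟩ : ∃ d, M = n + d := ⟨M - n, by omega⟩
          simp only [Nat.add_sub_cancel_left]
          ring
        rw [h1] at hp
        exact (Nat.dvd_add_right (Dvd.intro_left q rfl)).1 hp)
      (by dsimp only at h; ext <;> simp; omega) with h0 | h0
    · simp at h0; omega
    · simp at h0 h; omega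

/-- The multiplicity system `m₀, m₁, …, m_{s+1}` of the invariant monomial `z₁ ^ N * z₂ ^ M`,
`p = (N, M)`: it starts with `m₀ = M`, `m₁ = (N + q M) / n` (an exact division) and satisfies
`m_{v-1} - k_v m_v + m_{v+1} = 0` for `1 ≤ v ≤ s`.  Since `Fin s` starts at `0`, the
entry `k_{v+1}` is `k v`; the values beyond `m_{s+1}` are irrelevant and set to `0`. -/
def mult (n q : ℕ) {s : ℕ} (k : Fin s → ℕ) (p : ℕ × ℕ) : ℕ → ℤ
  | 0 => p.2
  | 1 => ((p.1 + q * p.2) / n : ℕ)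
  | v + 2 => if h : v < s then k ⟨v, h⟩ * mult n q k p (v + 1) - mult n q k p v else 0

/-! ### The minimal resolution -/

/-- The gluing of the charts `U₀, …, Uₛ`, copies of `ℂ²` with coordinates `(α, β)`:
consecutive charts are glued along `α_{v-1} ≠ 0`, `β_v ≠ 0` by
`β_v = α_{v-1}⁻¹`, `α_v = α_{v-1} ^ k_v * β_{v-1}`. -/
inductive Glue {s : ℕ} (k : Fin s → ℕ) : Fin (s + 1) × (ℂ × ℂ) → Fin (s + 1) × (ℂ × ℂ) → Prop
  | glue (v : Fin s) (a b : ℂ) (ha : a ≠ 0) :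
      Glue k (v.castSucc, (a, b)) (v.succ, (a ^ k v * b, a⁻¹))

/-- The (space of the) minimal resolution of the cyclic quotient singularity with
`n / q = [k₁, …, kₛ]`: the union of the charts `U₀, …, Uₛ` modulo the gluing. -/
def Resolution {s : ℕ} (k : Fin s → ℕ) : Type := Quot (Glue k)

/-- The chart `U_w → X̃`. -/
def chart {s : ℕ} (k : Fin s → ℕ) (w : Fin (s + 1)) (x : ℂ × ℂ) : Resolution k :=
  Quot.mk _ (w, x)

/-- The irreducible exceptional curve `E_v`, given by `β = 0` in the chart preceding it and by
`α = 0` in the chart following it. -/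
def excCurve {s : ℕ} (k : Fin s → ℕ) (v : Fin s) : Set (Resolution k) :=
  (chart k v.castSucc '' {x | x.2 = 0}) ∪ (chart k v.succ '' {x | x.1 = 0})

/-- The canonical map `Ψ = (g₀, …, g_{t+1}) : X̃ → ℂ^{t+2}`, with the coordinates of the target
indexed by the `t + 2` minimal generators.  In the chart `U_w` the component of multiplicity
system `m` is `α ^ m_w * β ^ m_{w+1}`. -/
def canonicalMap (n q : ℕ) {s : ℕ} (k : Fin s → ℕ) (x : Resolution k) : generators n q → ℂ :=
  fun p => Quot.lift
    (fun y : Fin (s + 1) × (ℂ × ℂ) =>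
      y.2.1 ^ mult n q k p y.1.val * y.2.2 ^ mult n q k p (y.1.val + 1))
    (by
      rintro _ _ ⟨v, a, b, ha⟩
      simp only [Fin.val_castSucc, Fin.val_succ]
      have h : mult n q k p (v + 1 + 1) =
          k v * mult n q k p (v + 1) - mult n q k p v := by
        rw [mult]; simp
      rw [h, mul_zpow, inv_zpow, ← zpow_neg, ← zpow_natCast, ← zpow_mul, mul_right_comm,
        ← zpow_add₀ ha]
      congr 2
      ring) x

/-- The map `Ψ` is the lift to `X̃` of the map `(z₁, z₂) ↦ (z₁ ^ N * z₂ ^ M)_{(N, M)}` on `ℂ²`, with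
respect to the parametrization `(z₁, z₂) ↦ (α₀, β₀) = (z₂ / z₁ ^ q, z₁ ^ n)` of the open torus. -/
theorem canonicalMap_monomial {n q : ℕ} {s : ℕ} (k : Fin s → ℕ) (hn : 0 < n)
    (z₁ z₂ : ℂ) (hz : z₁ ≠ 0) (p : generators n q) :
    canonicalMap n q k (chart k 0 (z₂ / z₁ ^ q, z₁ ^ n)) p = z₁ ^ p.1.1 * z₂ ^ p.1.2 := by
  obtain ⟨⟨N, M⟩, hp⟩ := p
  obtain ⟨c, hc⟩ : n ∣ N + q * M := ((mem_generators hn _).1 hp).1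
  simp only [canonicalMap, chart, Fin.val_zero, zero_add, mult, hc,
    Nat.mul_div_cancel_left _ hn, zpow_natCast]
  rw [← pow_mul, ← hc, div_pow, ← pow_mul, pow_add]
  field_simp

/-- The germ at `0` of `γ : ℂ → X̃` is a parametrized holomorphic disc which meets the exceptional
set only on `E_v` (at its centre `γ 0`) and is transversal to `E_v` there: in a chart around `γ 0`
it is analytic, and the derivative at `0` of the local equation of `E_v` along it is nonzero. -/
structure IsTransversalDisc {s : ℕ} (k : Fin s → ℕ) (v : Fin s) (γ : ℂ → Resolution k) :
    Prop where
  center_mem : γ 0 ∈ excCurve k v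
  center_notMem : ∀ w : Fin s, w ≠ v → γ 0 ∉ excCurve k w
  transversal : ∃ h : ℂ → ℂ × ℂ, AnalyticAt ℂ h 0 ∧
    ((γ =ᶠ[𝓝 0] (fun t => chart k v.castSucc (h t)) ∧
        (h 0).2 = 0 ∧ deriv (fun t => (h t).2) 0 ≠ 0) ∨
      (γ =ᶠ[𝓝 0] (fun t => chart k v.succ (h t)) ∧
        (h 0).1 = 0 ∧ deriv (fun t => (h t).1) 0 ≠ 0))

/-! ### Ordinary tuples -/

/-- The germs of the (reduced) analytic sets `A` at `a` and `B` at `b` are analytically isomorphic: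
there are analytic germs of the ambient spaces which restrict to mutually inverse maps. -/
def AnalyticGermIso {V W : Type*} [NormedAddCommGroup V] [NormedSpace ℂ V]
    [NormedAddCommGroup W] [NormedSpace ℂ W] (A : Set V) (a : V) (B : Set W) (b : W) : Prop :=
  ∃ (f : V → W) (g : W → V), AnalyticAt ℂ f a ∧ AnalyticAt ℂ g b ∧ f a = b ∧ g b = a ∧
    (∀ᶠ x in 𝓝[A] a, f x ∈ B ∧ g (f x) = x) ∧ (∀ᶠ y in 𝓝[B] b, g y ∈ A ∧ f (g y) = y)

/-- The union of the coordinate axes of `ℂ^r`. -/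
def coordinateAxes (r : ℕ) : Set (Fin r → ℂ) := {x | ∃ i, ∀ j, j ≠ i → x j = 0}

/-- The germ of `C` at `o` is an ordinary `r`-tuple. -/
def IsOrdinaryTuple {V : Type*} [NormedAddCommGroup V] [NormedSpace ℂ V] (r : ℕ) (C : Set V)
    (o : V) : Prop :=
  AnalyticGermIso C o (coordinateAxes r) 0

end CyclicQuotient

end

/-!
The tangent vector of a disc transversal to `E_v` at the point with homogeneous coordinates
`[A : B]` has, up to a common nonzero factor, the component `A ^ m_{v-1} * B ^ m_{v+1}` at each
generator of multiplicity `m_v = 1` along `E_v`, and `0` at all other generators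
(`IsTransversalDisc.tangent`). A generator with `m_v = 1` is determined by `x = m_{v-1}`, and
`m_{v+1} = k_v - x`, so the tangent vectors at the points of a single `E_v` are vectors of
monomials of degree `k_v`, independent by a (projective) Vandermonde determinant
(`eq_zero_of_window`).

Multiplicity systems are convex sequences because `k_v ≥ 2`. Together with the fact that the
continued fraction computes the last entry `m_{s+1}` as `n m₁ - q m₀`, this shows that `x` takes
exactly the values `lo ≤ x ≤ H`, where `lo` is `0` on the first curve and `1` on the others, and
`H` is `k_v` on the last curve and `k_v - 1` on the others
(`IsMultSeq.exists_generator`, `IsMultSeq.ends_nonneg`). So the generators with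
`m_v = 1` form a chain of length `1 + k_v - val_v`, and the chains of consecutive curves share
exactly their common endpoint, at which `m_v = m_{v+1} = 1`.

A linear relation between the tangent vectors is eliminated from the last curve backwards
(`elimination`). If `E_v` carries fewer points than its chain has members, the members other than
the first one, shared with the preceding curve, show that its coefficients vanish. If it carries as many, its vectors
span all vectors supported on the chain; then the relation restricts to one between the vectors
of the preceding curves and the basis vector of the shared generator, and the hypothesis on
`∑ r_v` leaves room for this one additional vector.

Finally, analytic branches with independent tangents form an ordinary tuple by the inverse function
theorem (`isOrdinaryTuple_of_linearIndependent`).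
-/

namespace CyclicQuotient

/-! ### Multiplicity systems -/

/-- `m₀, …, m_{s+1}` satisfies the recursion `m_{v-1} - k_v m_v + m_{v+1} = 0` along the string. -/
def IsMultSeq {s : ℕ} (k : Fin s → ℕ) (m : ℕ → ℤ) : Prop :=
  ∀ v : Fin s, m (v + 2) = k v * m (v + 1) - m v

theorem isMultSeq_mult (n q : ℕ) {s : ℕ} (k : Fin s → ℕ) (p : ℕ × ℕ) :
    IsMultSeq k (mult n q k p) := by
  intro v
  rw [mult]
  simp

theorem IsMultSeq.neg {s : ℕ} {k : Fin s → ℕ} {m : ℕ → ℤ} (hm : IsMultSeq k m) :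
    IsMultSeq k (-m) := by
  intro v
  simp only [Pi.neg_apply, hm v]
  ring

/-- Convexity of a multiplicity system, to the right: if at one place it is nonnegative and grows
by at least `e ≥ 0`, then it grows by at least `e` at each later place. -/
theorem IsMultSeq.grow_right {s : ℕ} {k : Fin s → ℕ} (hk : ∀ v, 2 ≤ k v) {m : ℕ → ℤ}
    (hm : IsMultSeq k m) {e c : ℤ} (he : 0 ≤ e) (hc : 0 ≤ c) {v : ℕ} (h1 : c ≤ m (v + 1))
    (h2 : m v + e ≤ m (v + 1)) {w : ℕ} (hvw : v ≤ w) (hws : w ≤ s) :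
    c ≤ m (w + 1) ∧ m w + e ≤ m (w + 1) := by
  induction w, hvw using Nat.le_induction with
  | base => exact ⟨h1, h2⟩
  | succ w hvw ih =>
    obtain ⟨ih1, ih2⟩ := ih (by omega)
    have h := hm ⟨w, hws⟩
    have hk' : (2 : ℤ) ≤ k ⟨w, hws⟩ := by exact_mod_cast hk _
    simp only at h
    have := mul_le_mul_of_nonneg_right hk' (hc.trans ih1)
    rw [show w + 1 + 1 = w + 2 from rfl, h]
    constructor <;> linarith

/-- Convexity of a multiplicity system, to the left. -/
theorem IsMultSeq.grow_left {s : ℕ} {k : Fin s → ℕ} (hk : ∀ v, 2 ≤ k v) {m : ℕ → ℤ}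
    (hm : IsMultSeq k m) {e c : ℤ} (he : 0 ≤ e) (hc : 0 ≤ c) {v : ℕ} (hvs : v ≤ s) (h1 : c ≤ m v)
    (h2 : m (v + 1) + e ≤ m v) {w : ℕ} (hwv : w ≤ v) :
    c ≤ m w ∧ m (w + 1) + e ≤ m w := by
  induction hwv using Nat.decreasingInduction with
  | self => exact ⟨h1, h2⟩
  | of_succ w hwv ih =>
    obtain ⟨ih1, ih2⟩ := ih
    have h := hm ⟨w, by omega⟩
    have hk' : (2 : ℤ) ≤ k ⟨w, by omega⟩ := by exact_mod_cast hk _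
    simp only at h
    have := mul_le_mul_of_nonneg_right hk' (hc.trans ih1)
    rw [show w + 1 + 1 = w + 2 from rfl] at ih2
    constructor <;> linarith

/-- A multiplicity system with nonnegative ends and `m₁ > 0` is positive at all inner places. -/
theorem IsMultSeq.pos {s : ℕ} {k : Fin s → ℕ} (hk : ∀ v, 2 ≤ k v) {m : ℕ → ℤ}
    (hm : IsMultSeq k m) (hs : 0 ≤ m (s + 1)) (h1 : 0 < m 1) :
    ∀ v < s, 0 < m (v + 1) := by
  intro v
  induction v with
  | zero => exact fun _ => h1
  | succ v ih =>
    intro hv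
    by_contra! hneg
    have hpos := ih (by omega)
    -- after a nonpositive value following a positive one, the system decreases up to its end
    have h := (hm.neg.grow_right hk (e := 1) (c := 0) zero_le_one le_rfl (v := v + 1)
      (by simpa using hneg) (by simp only [Pi.neg_apply]; omega) (w := s) hv.le le_rfl)
    have h' := (hm.neg.grow_right hk (e := 1) (c := 0) zero_le_one le_rfl (v := v + 1)
      (by simpa using hneg) (by simp only [Pi.neg_apply]; omega) (w := s - 1) (by omega)
      (by omega))
    simp only [Pi.neg_apply] at h h'
    rw [Nat.sub_add_cancel (by omega)] at h'
    omega

theorem IsMultSeq.exists_of_eq {s : ℕ} (k : Fin s → ℕ) {v : ℕ} (hv : v ≤ s) (x y : ℤ) :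
    ∃ m, IsMultSeq k m ∧ m v = x ∧ m (v + 1) = y := by
  induction v generalizing x y with
  | zero =>
    let m' : ℕ → ℤ × ℤ := fun n => Nat.rec (x, y)
      (fun i z => (z.2, if h : i < s then k ⟨i, h⟩ * z.2 - z.1 else 0)) n
    refine ⟨fun n => (m' n).1, fun v => ?_, rfl, rfl⟩
    simp [m']
  | succ v ih =>
    obtain ⟨m, hm, h1, h2⟩ := ih (by omega) (k ⟨v, hv⟩ * x - y) x
    refine ⟨m, hm, h2, ?_⟩
    have := hm ⟨v, hv⟩
    simp only at this
    rw [show v + 1 + 1 = v + 2 from rfl, this, h1, h2]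
    ring

theorem IsMultSeq.eq_left {s : ℕ} {k : Fin s → ℕ} {m m' : ℕ → ℤ} (hm : IsMultSeq k m)
    (hm' : IsMultSeq k m') {v : ℕ} (hv : v ≤ s) (h1 : m v = m' v) (h2 : m (v + 1) = m' (v + 1))
    {w : ℕ} (hw : w ≤ v + 1) : m w = m' w := by
  suffices H : ∀ w ≤ v, m w = m' w ∧ m (w + 1) = m' (w + 1) by
    rcases Nat.le_succ_iff.1 hw with h | rfl
    · exact (H w h).1
    · exact h2
  intro w hw
  induction hw using Nat.decreasingInduction with
  | self => exact ⟨h1, h2⟩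
  | of_succ w hw ih =>
    have a := hm ⟨w, by omega⟩
    have b := hm' ⟨w, by omega⟩
    simp only at a b
    obtain ⟨ih1, ih2⟩ := ih
    rw [show w + 1 + 1 = w + 2 from rfl, a, b, ih1] at ih2
    exact ⟨by linarith, ih1⟩

theorem IsMultSeq.eq_right {s : ℕ} {k : Fin s → ℕ} {m m' : ℕ → ℤ} (hm : IsMultSeq k m)
    (hm' : IsMultSeq k m') (h0 : m 0 = m' 0) (h1 : m 1 = m' 1) {w : ℕ} (hw : w ≤ s) :
    m w = m' w ∧ m (w + 1) = m' (w + 1) := by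
  induction w with
  | zero => exact ⟨h0, h1⟩
  | succ w ih =>
    obtain ⟨a, b⟩ := ih (by omega)
    refine ⟨b, ?_⟩
    have c := hm ⟨w, hw⟩
    have d := hm' ⟨w, hw⟩
    simp only at c d
    rw [show w + 1 + 1 = w + 2 from rfl, c, d, a, b]

/-! ### Multiplicity systems and minimal generators -/

/-- The numerator `a` and denominator `b` of a Hirzebruch–Jung continued fraction compute the last
entry of a multiplicity system from its first two.  The empty fraction is encoded as `1 / 0`. -/
theorem hjValue_recursion (l : List ℕ) (hl : ∀ x ∈ l, 2 ≤ x) :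
    ∃ a b : ℕ, a.Coprime b ∧ b < a ∧ hjValue l = a / b ∧ (l ≠ [] → b ≠ 0) ∧
      ∀ m : ℕ → ℤ, (∀ (i : ℕ) (h : i < l.length), m (i + 2) = l[i] * m (i + 1) - m i) →
        m (l.length + 1) = a * m 1 - b * m 0 := by
  induction l with
  | nil => exact ⟨1, 0, by simp, by simp, by simp [hjValue], by simp, fun m _ => by simp⟩
  | cons x l ih =>
    obtain ⟨a, b, hab, hlt, hval, -, hrec⟩ := ih fun y hy => hl y (List.mem_cons_of_mem _ hy)
    have hx : 2 ≤ x := hl x List.mem_cons_self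
    have hle : 2 * a ≤ x * a := Nat.mul_le_mul_right _ hx
    refine ⟨x * a - b, a, ?_, by omega, ?_, fun _ => by omega, fun m hm => ?_⟩
    · refine Nat.Coprime.symm ?_
      have h : b + (x * a - b) = a * x := by rw [mul_comm a]; omega
      have hd := Nat.dvd_gcd (Nat.gcd_dvd_left a (x * a - b))
        ((Nat.dvd_add_left (Nat.gcd_dvd_right a (x * a - b))).1
          (h ▸ (Nat.gcd_dvd_left a (x * a - b)).mul_right x))
      rwa [hab.gcd_eq_one, Nat.dvd_one] at hd
    · have ha : (a : ℚ) ≠ 0 := by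
        have : a ≠ 0 := by omega
        exact_mod_cast this
      rw [hjValue, hval, Nat.cast_sub (by omega), one_div_div]
      push_cast
      field_simp
    · have h0 := hm 0 (by simp)
      have := hrec (fun i => m (i + 1)) fun i hi => by
        have := hm (i + 1) (by simpa using hi)
        simpa using this
      simp only [List.length_cons, List.getElem_cons_zero, zero_add] at h0 this ⊢
      rw [this, Nat.cast_sub (by omega), h0]
      push_cast
      ring

/-- For `n / q = [k₁, …, kₛ]` the last entry of a multiplicity system is `n m₁ - q m₀`; for the
system of a monomial `z₁ ^ N * z₂ ^ M` it is `N`. -/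
theorem IsMultSeq.last_eq {n q : ℕ} (hq : 0 < q) (hqn : q < n) (hcop : Nat.Coprime n q)
    {s : ℕ} {k : Fin s → ℕ} (hk : ∀ v, 2 ≤ k v)
    (hnq : hjValue (List.ofFn k) = (n : ℚ) / (q : ℚ)) {m : ℕ → ℤ} (hm : IsMultSeq k m) :
    m (s + 1) = n * m 1 - q * m 0 := by
  obtain ⟨a, b, hab, -, hval, hb, hrec⟩ := hjValue_recursion (List.ofFn k)
    (by simpa [List.mem_ofFn] using hk)
  have hq' : (q : ℚ) ≠ 0 := by exact_mod_cast hq.ne'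
  have hn' : (n : ℚ) ≠ 0 := by exact_mod_cast (hq.trans hqn).ne'
  have hb0 : b ≠ 0 := hb fun h => by
    rw [h, hjValue, eq_comm, div_eq_zero_iff] at hnq
    tauto
  have hb' : (b : ℚ) ≠ 0 := by exact_mod_cast hb0
  have h1 : a * q = n * b := by
    rw [hnq, div_eq_div_iff hq' hb'] at hval
    exact_mod_cast hval.symm
  have h2 : a = n := Nat.dvd_antisymm (hab.dvd_of_dvd_mul_right ⟨q, h1.symm⟩)
    (hcop.dvd_of_dvd_mul_right ⟨b, h1⟩)
  have h3 : b = q := by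
    subst h2
    exact (Nat.eq_of_mul_eq_mul_left (hq.trans hqn) h1).symm
  subst h2 h3
  have := hrec m fun i hi => by
    have := hm ⟨i, by simpa using hi⟩
    simpa using this
  simpa using this

theorem mult_add {n q : ℕ} {s : ℕ} (k : Fin s → ℕ) {a b : ℕ × ℕ}
    (ha : IsInvariant n q a) (v : ℕ) :
    mult n q k (a + b) v = mult n q k a v + mult n q k b v := by
  induction v using Nat.twoStepInduction with
  | zero => simp [mult]
  | one =>
    have h : a.1 + b.1 + q * (a.2 + b.2) = (a.1 + q * a.2) + (b.1 + q * b.2) := by ring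
    simp only [mult, Prod.fst_add, Prod.snd_add]
    rw [h, Nat.add_div_of_dvd_right ha]
    push_cast
    rfl
  | more v h1 h2 =>
    simp only [mult]
    split_ifs
    · rw [h1, h2]; ring
    · rfl

theorem mult_one_mul {n q : ℕ} {s : ℕ} (k : Fin s → ℕ) {p : ℕ × ℕ} (hp : IsInvariant n q p) :
    n * mult n q k p 1 = p.1 + q * p.2 := by
  simp only [mult]
  exact_mod_cast Nat.mul_div_cancel' hp

/-- A nonconstant invariant monomial pulls back to a function vanishing on all exceptional curves. -/
theorem mult_pos {n q : ℕ} (hq : 0 < q) (hqn : q < n) (hcop : Nat.Coprime n q)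
    {s : ℕ} {k : Fin s → ℕ} (hk : ∀ v, 2 ≤ k v)
    (hnq : hjValue (List.ofFn k) = (n : ℚ) / (q : ℚ)) {p : ℕ × ℕ} (hp : IsInvariant n q p)
    (hp0 : p ≠ 0) : ∀ v < s, 0 < mult n q k p (v + 1) := by
  have hm := isMultSeq_mult n q k p
  have h1 := mult_one_mul k hp
  refine hm.pos hk ?_ ?_
  · rw [hm.last_eq hq hqn hcop hk hnq, h1]
    simp [mult]
  · have : 0 < p.1 + q * p.2 := by
      rcases Nat.eq_zero_or_pos p.1 with h | h
      · rcases Nat.eq_zero_or_pos p.2 with h' | h'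
        · exact absurd (Prod.ext h h') hp0
        · positivity
      · positivity
    have h' : (0 : ℤ) < n * mult n q k p 1 := by rw [h1]; exact_mod_cast this
    exact pos_of_mul_pos_right h' (by positivity)

theorem mult_last_nonneg {n q : ℕ} (hq : 0 < q) (hqn : q < n) (hcop : Nat.Coprime n q)
    {s : ℕ} {k : Fin s → ℕ} (hk : ∀ v, 2 ≤ k v)
    (hnq : hjValue (List.ofFn k) = (n : ℚ) / (q : ℚ)) {p : ℕ × ℕ} (hp : IsInvariant n q p) :
    0 ≤ mult n q k p (s + 1) := by
  rw [(isMultSeq_mult n q k p).last_eq hq hqn hcop hk hnq, mult_one_mul k hp]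
  simp [mult]

/-- An invariant monomial of multiplicity one along some exceptional curve cannot be decomposed,
so each multiplicity system with nonnegative ends and an entry `1` is that of a generator. -/
theorem IsMultSeq.exists_generator {n q : ℕ} (hq : 0 < q) (hqn : q < n) (hcop : Nat.Coprime n q)
    {s : ℕ} {k : Fin s → ℕ} (hk : ∀ v, 2 ≤ k v)
    (hnq : hjValue (List.ofFn k) = (n : ℚ) / (q : ℚ)) {m : ℕ → ℤ} (hm : IsMultSeq k m)
    (h0 : 0 ≤ m 0) (hs : 0 ≤ m (s + 1)) {v : ℕ} (hv : v < s) (h1 : m (v + 1) = 1) :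
    ∃ p ∈ generators n q, ∀ w ≤ s + 1, mult n q k p w = m w := by
  have hn : 0 < n := hq.trans hqn
  obtain ⟨M, hM⟩ := Int.eq_ofNat_of_zero_le h0
  obtain ⟨N, hN⟩ := Int.eq_ofNat_of_zero_le hs
  have hlast := hm.last_eq hq hqn hcop hk hnq
  have hinv : IsInvariant n q (N, M) := by
    have : (n : ℤ) ∣ ((N + q * M : ℕ) : ℤ) := ⟨m 1, by push_cast; rw [← hM, ← hN]; linarith⟩
    exact_mod_cast this
  have hmult1 : mult n q k (N, M) 1 = m 1 := by
    have h := mult_one_mul k hinv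
    have hn' : (n : ℤ) ≠ 0 := by exact_mod_cast hn.ne'
    apply mul_left_cancel₀ hn'
    rw [h]
    simp only
    rw [← hM, ← hN]
    linarith
  have hmult : ∀ w ≤ s + 1, mult n q k (N, M) w = m w := by
    intro w hw
    have key := fun w (hw : w ≤ s) => (isMultSeq_mult n q k (N, M)).eq_right hm
      (by simp [mult, hM]) hmult1 hw
    rcases Nat.le_succ_iff.1 hw with h | rfl
    · exact (key w h).1
    · exact (key s le_rfl).2
  refine ⟨(N, M), (mem_generators hn _).2 ⟨hinv, ?_, ?_⟩, hmult⟩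
  · intro h
    have := hmult (v + 1) (by omega)
    rw [h1, h] at this
    have h00 : ∀ w, mult n q k 0 w = 0 := by
      intro w
      have := mult_add k (a := 0) (b := 0) (n := n) (q := q) (by simp [IsInvariant]) w
      rw [add_zero] at this
      linarith
    rw [h00] at this
    omega
  · intro a b ha hb hab
    by_contra! hne
    have hpa := mult_pos hq hqn hcop hk hnq ha hne.1 v hv
    have hpb := mult_pos hq hqn hcop hk hnq hb hne.2 v hv
    have := hmult (v + 1) (by omega)
    rw [hab, mult_add k ha, h1] at this
    omega

/-! ### Independence along a chain of curves -/

/-- The case `r = N` of `eq_zero_of_window`: the matrix of coefficients is a projective Vandermonde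
matrix up to nonzero factors of its rows. -/
theorem eq_zero_of_window_card_eq {r K a : ℕ} (A B c : Fin r → ℂ)
    (hne : ∀ i j, i ≠ j → A i * B j ≠ A j * B i) (hA : a ≠ 0 → ∀ i, A i ≠ 0)
    (hB : a + r ≠ K + 1 → ∀ i, B i ≠ 0) (haK : a + r ≤ K + 1)
    (h : ∀ x, a ≤ x → x < a + r → ∑ i, c i * (A i ^ x * B i ^ (K - x)) = 0) : c = 0 := by
  let c' : Fin r → ℂ := fun i => c i * (A i ^ a * B i ^ (K + 1 - a - r))
  have hdet : (Matrix.projVandermonde A B).det ≠ 0 := by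
    rw [Matrix.det_projVandermonde]
    refine Finset.prod_ne_zero_iff.2 fun i _ => Finset.prod_ne_zero_iff.2 fun j hj => ?_
    exact sub_ne_zero.2 (hne j i (Finset.mem_Ioi.1 hj).ne')
  have hc' : c' = 0 := by
    refine Matrix.eq_zero_of_vecMul_eq_zero hdet (funext fun j => ?_)
    refine Eq.trans ?_ (h (a + j) (by omega) (by omega))
    change ∑ i, c' i * Matrix.projVandermonde A B i j = _
    refine Finset.sum_congr rfl fun i _ => ?_
    have e : K - (a + j) = (K + 1 - a - r) + j.rev.1 := by
      rw [Fin.val_rev]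
      omega
    rw [Matrix.projVandermonde_apply, e, pow_add, pow_add]
    simp only [c']
    ring
  funext i
  have hi := congrFun hc' i
  simp only [c', Pi.zero_apply] at hi ⊢
  refine (mul_eq_zero.1 hi).resolve_right (mul_ne_zero ?_ ?_)
  · by_cases h0 : a = 0
    · simp [h0]
    · exact pow_ne_zero _ (hA h0 i)
  · by_cases h0 : a + r = K + 1
    · simp [show K + 1 - a - r = 0 by omega]
    · exact pow_ne_zero _ (hB h0 i)

/-- Vanishing of `N` consecutive coefficients forces a combination of the vectors
`(A ^ x * B ^ (K - x))_x` at `r ≤ N` different points `[A : B]` of the projective line to be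
trivial. The points `[0 : 1]` and `[1 : 0]` are admitted when the window reaches the corresponding
end. -/
theorem eq_zero_of_window {r N K a : ℕ} (hrN : r ≤ N) (haK : a + N ≤ K + 1) (A B c : Fin r → ℂ)
    (hAB : ∀ i, A i ≠ 0 ∨ B i ≠ 0) (hne : ∀ i j, i ≠ j → A i * B j ≠ A j * B i)
    (hA : a ≠ 0 → ∀ i, A i ≠ 0) (hB : a + N ≠ K + 1 → ∀ i, B i ≠ 0)
    (h : ∀ x, a ≤ x → x < a + N → ∑ i, c i * (A i ^ x * B i ^ (K - x)) = 0) : c = 0 := by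
  induction hrN using Nat.decreasingInduction with
  | self => exact eq_zero_of_window_card_eq A B c hne hA hB haK h
  | of_succ r hr ih =>
    -- add a further point `[1 : t]` with coefficient `0`
    obtain ⟨t, ht⟩ := Infinite.exists_notMem_finset
      (insert 0 (Finset.univ.image fun i => B i / A i))
    simp only [Finset.mem_insert, Finset.mem_image, Finset.mem_univ, true_and, not_or,
      not_exists] at ht
    have hAt : ∀ i, A i * t ≠ B i := by
      intro i heq
      by_cases hAi : A i = 0
      · rcases hAB i with h | h
        · exact h hAi
        · rw [hAi, zero_mul] at heq
          exact h heq.symm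
      · exact ht.2 i (by rw [← heq]; field_simp)
    have := ih (Fin.snoc (α := fun _ => ℂ) A 1) (Fin.snoc (α := fun _ => ℂ) B t)
      (Fin.snoc (α := fun _ => ℂ) c 0)
      (fun i => by refine Fin.lastCases ?_ (fun i => ?_) i <;> simp [hAB])
      (fun i j => by
        refine Fin.lastCases ?_ (fun i => ?_) i <;> refine Fin.lastCases ?_ (fun j => ?_) j
        · simp
        · simpa [eq_comm] using hAt j
        · simpa using hAt i
        · simpa using hne i j)
      (fun ha i => by refine Fin.lastCases ?_ (fun i => ?_) i <;> simp [hA ha])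
      (fun hb i => by refine Fin.lastCases ?_ (fun i => ?_) i <;> simp [hB hb, ht.1])
      (fun x h1 h2 => by simpa [Fin.sum_univ_castSucc] using h x h1 h2)
    funext i
    simpa using congrFun this i.castSucc

/-- Elimination along a string.  The curve `v` contributes `F v x` at the places
`lo v ≤ x ≤ H v`, the last place of a curve being identified with the first of the next one; the
total contribution at each place is zero, and `T (v + 1)` is the contribution of the curves up
to `v` at the last place of `v`.  If `F v` vanishes at `r v` consecutive places, then it is trivial
(`Z v`); on the first (last) curve this is only known for windows starting at the first (ending at
the last) place.  The parameter `δ = 1` allows for one more point, situated at the end of the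
initial string under consideration. -/
theorem elimination {s : ℕ} (F : ℕ → ℕ → ℂ) (lo H r : ℕ → ℕ) (T : ℕ → ℂ) (Z : ℕ → Prop)
    (hlo : ∀ v < s, lo v ≤ H v)
    (hZ : ∀ v < s, ∀ a b, lo v ≤ a → b ≤ H v + 1 → a + r v ≤ b → (v = 0 → a = lo v) →
      (v + 1 = s → b = H v + 1) → (∀ x, a ≤ x → x < b → F v x = 0) → Z v)
    (hF : ∀ v < s, Z v → ∀ x, F v x = 0) (hT0 : T 0 = 0)
    (hG : ∀ v < s, ∀ x, lo v ≤ x → x < H v → F v x + (if x = lo v then T v else 0) = 0)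
    (hT : ∀ v < s, F v (H v) + (if H v = lo v then T v else 0) = T (v + 1))
    (hr : ∀ v₁ w, v₁ < w → w ≤ s →
      ∑ v ∈ Finset.Ico v₁ w, (r v : ℤ) ≤ 1 + ∑ v ∈ Finset.Ico v₁ w, ((H v : ℤ) - lo v))
    (w : ℕ) (hw : w ≤ s) (δ : ℕ) (hδ : δ ≤ 1) (hδs : w = s → δ = 0) (hδT : δ = 0 → T w = 0)
    (hrδ : ∀ v₁ < w, ∑ v ∈ Finset.Ico v₁ w, (r v : ℤ) + δ ≤
      1 + ∑ v ∈ Finset.Ico v₁ w, ((H v : ℤ) - lo v)) :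
    T w = 0 ∧ ∀ v < w, Z v := by
  induction w generalizing δ with
  | zero => exact ⟨hT0, by simp⟩
  | succ w ih =>
    have hws : w < s := hw
    have hlow := hlo w hws
    have hTw := hT w hws
    have hfin : Z w → T w = 0 → T (w + 1) = 0 := fun h1 h2 => by
      rw [← hTw, hF w hws h1, h2]; simp
    have hlast : r w + δ ≤ 1 + (H w - lo w) := by
      have := hrδ w (by omega)
      simp only [Nat.Ico_succ_singleton, Finset.sum_singleton] at this
      omega
    -- places where nothing is carried over from the preceding curves
    have hzero : ∀ x, lo w ≤ x → x < H w + 1 - δ → (x = lo w → T w = 0) → F w x = 0 := by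
      intro x h1 h2 h3
      have h4 : (if x = lo w then T w else 0) = 0 := by
        split_ifs with h
        · exact h3 h
        · rfl
      rcases Nat.lt_or_ge x (H w) with h | h
      · simpa [h4] using hG w hws x h1 h
      · obtain rfl : x = H w := by omega
        rw [hδT (by omega), h4] at hTw
        simpa using hTw
    suffices hmain : T w = 0 ∧ (∀ v < w, Z v) ∧ Z w by
      refine ⟨hfin hmain.2.2 hmain.1, fun v hv => ?_⟩
      rcases Nat.lt_succ_iff_lt_or_eq.1 hv with h | rfl
      · exact hmain.2.1 v h
      · exact hmain.2.2
    by_cases hcase : r w + δ ≤ H w - lo w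
    · -- few points: the places other than the first one already determine them
      have hZw : Z w := by
        by_cases h0 : w = 0
        · subst h0
          exact hZ 0 hws (lo 0) (H 0 + 1 - δ) le_rfl (by omega) (by omega) (fun _ => rfl)
            (fun h => by rw [hδs h]; rfl) fun x h1 h2 => hzero x h1 h2 fun _ => hT0
        · exact hZ w hws (lo w + 1) (H w + 1 - δ) (by omega) (by omega) (by omega)
            (fun h => absurd h h0) (fun h => by rw [hδs h]; rfl)
            fun x h1 h2 => hzero x (by omega) h2 (by omega)
      have hT' : T w = 0 := by
        by_cases heq : H w = lo w
        · rw [hδT (by omega), if_pos heq, hF w hws hZw] at hTw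
          simpa using hTw
        · simpa [hF w hws hZw] using hG w hws (lo w) le_rfl (by omega)
      have := ih hws.le 0 (by omega) (by omega) (fun _ => hT')
        (by simpa using fun v₁ h => hr v₁ w h hws.le)
      exact ⟨this.1, this.2, hZw⟩
    · -- as many points as places: they account for one more point on the preceding string
      have hrw : r w + δ = 1 + (H w - lo w) := by omega
      have := ih hws.le 1 le_rfl (by omega) (by simp) fun v₁ h => by
        have := hrδ v₁ (by omega)
        rw [Finset.sum_Ico_succ_top h.le, Finset.sum_Ico_succ_top h.le] at this
        push_cast
        have h3 : (r w : ℤ) + δ = 1 + (H w - lo w) := by omega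
        linarith
      exact ⟨this.1, this.2, hZ w hws (lo w) (H w + 1 - δ) le_rfl (by omega) (by omega)
        (fun _ => rfl) (fun h => by rw [hδs h]; rfl)
        fun x h1 h2 => hzero x h1 h2 fun _ => this.1⟩

/-! ### Transversal discs -/

theorem chart_glue {s : ℕ} (k : Fin s → ℕ) (v : Fin s) {a : ℂ} (b : ℂ) (ha : a ≠ 0) :
    chart k v.castSucc (a, b) = chart k v.succ (a ^ k v * b, a⁻¹) :=
  Quot.sound (Glue.glue v a b ha)

/-- The point `x` of the curve `E_v` has homogeneous coordinates `[A : B]`, normalized by `B = 1`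
or by `A = 1`, where `α = A / B` in the chart preceding `E_v` and `β = B / A` in the next one. -/
def HasCoords {s : ℕ} (k : Fin s → ℕ) (v : Fin s) (A B : ℂ) (x : Resolution k) : Prop :=
  (B = 1 ∧ x = chart k v.castSucc (A, 0)) ∨ (A = 1 ∧ x = chart k v.succ (0, B))

theorem HasCoords.eq_of_mul_eq {s : ℕ} {k : Fin s → ℕ} {v : Fin s}
    {A B A' B' : ℂ} {x x' : Resolution k} (h : HasCoords k v A B x) (h' : HasCoords k v A' B' x')
    (heq : A * B' = A' * B) : x = x' := by
  have key : ∀ a b : ℂ, a * b = 1 → chart k v.castSucc (a, 0) = chart k v.succ (0, b) := by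
    intro a b hab
    rw [chart_glue k v 0 (left_ne_zero_of_mul_eq_one hab), mul_zero, eq_inv_of_mul_eq_one_right hab]
  rcases h with ⟨rfl, rfl⟩ | ⟨rfl, rfl⟩ <;> rcases h' with ⟨rfl, rfl⟩ | ⟨rfl, rfl⟩
  · simp_all
  · exact key _ _ (by simpa using heq)
  · exact (key _ _ (by simpa using heq.symm)).symm
  · simp_all

/-- The point `[0 : 1]` of `E_v` lies on the preceding curve, if there is one. -/
theorem HasCoords.left_ne_zero {s : ℕ} {k : Fin s → ℕ} {v : Fin s} {A B : ℂ} {x : Resolution k}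
    (h : HasCoords k v A B x) (hx : ∀ w : Fin s, w ≠ v → x ∉ excCurve k w) (hv : v.val ≠ 0) :
    A ≠ 0 := by
  rcases h with ⟨-, rfl⟩ | ⟨rfl, -⟩
  · rintro rfl
    let w : Fin s := ⟨v - 1, by omega⟩
    have hw : v.castSucc = w.succ := Fin.ext (by simp [w]; omega)
    refine hx w (fun h => ?_) (Or.inr ⟨(0, 0), rfl, by rw [hw]⟩)
    have := congrArg Fin.val h
    simp [w] at this
    omega
  · exact one_ne_zero

/-- The point `[1 : 0]` of `E_v` lies on the next curve, if there is one. -/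
theorem HasCoords.right_ne_zero {s : ℕ} {k : Fin s → ℕ} {v : Fin s} {A B : ℂ} {x : Resolution k}
    (h : HasCoords k v A B x) (hx : ∀ w : Fin s, w ≠ v → x ∉ excCurve k w) (hv : v.val + 1 ≠ s) :
    B ≠ 0 := by
  rcases h with ⟨rfl, -⟩ | ⟨-, rfl⟩
  · exact one_ne_zero
  · rintro rfl
    let w : Fin s := ⟨v + 1, by omega⟩
    have hw : v.succ = w.castSucc := Fin.ext (by simp [w])
    refine hx w (fun h => ?_) (Or.inl ⟨(0, 0), rfl, by rw [hw]⟩)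
    have := congrArg Fin.val h
    simp [w] at this

theorem analyticAt_monomial {f g : ℂ → ℂ} (hf : AnalyticAt ℂ f 0) (hg : AnalyticAt ℂ g 0)
    (hg0 : g 0 = 0) {a b : ℤ} (ha : 0 ≤ a) (hb : 0 < b) :
    AnalyticAt ℂ (fun t => f t ^ a * g t ^ b) 0 ∧ f 0 ^ a * g 0 ^ b = 0 ∧
      deriv (fun t => f t ^ a * g t ^ b) 0 = if b = 1 then deriv g 0 * f 0 ^ a else 0 := by
  lift a to ℕ using ha
  lift b to ℕ using hb.le
  have hb' : b ≠ 0 := by rintro rfl; simp at hb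
  simp only [zpow_natCast]
  refine ⟨(hf.pow a).mul (hg.pow b), by simp [hg0, hb'], ?_⟩
  have h := (hf.differentiableAt.hasDerivAt.fun_pow a).fun_mul
    (hg.differentiableAt.hasDerivAt.fun_pow b)
  rw [h.deriv, hg0, zero_pow hb', mul_zero, zero_add]
  by_cases h1 : b = 1
  · simp [h1, mul_comm]
  · have : b - 1 ≠ 0 := by omega
    simp [h1, zero_pow this]

/-- The image of a transversal disc under the canonical map is analytic, and its tangent vector is
up to a nonzero factor the vector of the monomials `A ^ m_{v-1} * B ^ m_{v+1}` at the coordinates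
`[A : B]` of the centre, for those generators which have multiplicity `m_v = 1` on `E_v`. -/
theorem IsTransversalDisc.tangent {n q : ℕ} (hq : 0 < q) (hqn : q < n) (hcop : Nat.Coprime n q)
    {s : ℕ} {k : Fin s → ℕ} (hk : ∀ v, 2 ≤ k v)
    (hnq : hjValue (List.ofFn k) = (n : ℚ) / (q : ℚ)) {v : Fin s} {γ : ℂ → Resolution k}
    (hγ : IsTransversalDisc k v γ) :
    AnalyticAt ℂ (fun t => canonicalMap n q k (γ t)) 0 ∧ canonicalMap n q k (γ 0) = 0 ∧
      ∃ A B c : ℂ, c ≠ 0 ∧ HasCoords k v A B (γ 0) ∧ ∀ p : generators n q,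
        deriv (fun t => canonicalMap n q k (γ t)) 0 p =
          if mult n q k p (v + 1) = 1 then
            c * (A ^ mult n q k p v * B ^ mult n q k p (v + 2)) else 0 := by
  have hpos : ∀ (p : generators n q), ∀ w < s, 0 < mult n q k p (w + 1) := fun p =>
    have hp := (mem_generators (hq.trans hqn) _).1 p.2
    mult_pos hq hqn hcop hk hnq hp.1 hp.2.1
  have hnonneg : ∀ (p : generators n q), ∀ w ≤ s + 1, 0 ≤ mult n q k p w := by
    intro p w hw
    rcases w with _ | w
    · simp [mult]
    · rcases Nat.lt_or_ge w s with h | h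
      · exact (hpos p w h).le
      · obtain rfl : w = s := by omega
        exact mult_last_nonneg hq hqn hcop hk hnq ((mem_generators (hq.trans hqn) _).1 p.2).1
  -- it suffices to know each component near the centre
  have main : ∀ (φ : generators n q → ℂ → ℂ) (d : generators n q → ℂ),
      (∀ᶠ t in 𝓝 0, ∀ p, canonicalMap n q k (γ t) p = φ p t) →
      (∀ p, AnalyticAt ℂ (φ p) 0 ∧ φ p 0 = 0 ∧ deriv (φ p) 0 = d p) →
      AnalyticAt ℂ (fun t => canonicalMap n q k (γ t)) 0 ∧ canonicalMap n q k (γ 0) = 0 ∧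
        ∀ p, deriv (fun t => canonicalMap n q k (γ t)) 0 p = d p := by
    intro φ d hev hφ
    have heq : (fun t => canonicalMap n q k (γ t)) =ᶠ[𝓝 0] fun t p => φ p t :=
      hev.mono fun t ht => funext ht
    refine ⟨(analyticAt_pi_iff.2 fun p => (hφ p).1).congr heq.symm, ?_, fun p => ?_⟩
    · refine heq.self_of_nhds.trans ?_
      exact funext fun p => (hφ p).2.1
    · rw [heq.deriv_eq, deriv_pi fun p => (hφ p).1.differentiableAt]
      exact (hφ p).2.2
  obtain ⟨h, hh, ⟨hev, h0, hd⟩ | ⟨hev, h0, hd⟩⟩ := hγ.transversal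
  · have hf : AnalyticAt ℂ (fun t => (h t).1) 0 := analyticAt_fst.comp hh
    have hg : AnalyticAt ℂ (fun t => (h t).2) 0 := analyticAt_snd.comp hh
    obtain ⟨m1, m2, m3⟩ := main
      (fun p t => (h t).1 ^ mult n q k p v * (h t).2 ^ mult n q k p (v + 1)) _
      (hev.mono fun t ht p => by rw [ht]; rfl)
      (fun p => analyticAt_monomial hf hg h0 (hnonneg p v (by omega)) (hpos p v v.2))
    refine ⟨m1, m2, (h 0).1, 1, _, hd, Or.inl ⟨rfl, ?_⟩, fun p => by simpa using m3 p⟩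
    exact hev.self_of_nhds.trans (congrArg _ (Prod.ext rfl h0))
  · have hf : AnalyticAt ℂ (fun t => (h t).1) 0 := analyticAt_fst.comp hh
    have hg : AnalyticAt ℂ (fun t => (h t).2) 0 := analyticAt_snd.comp hh
    obtain ⟨m1, m2, m3⟩ := main
      (fun p t => (h t).2 ^ mult n q k p (v + 2) * (h t).1 ^ mult n q k p (v + 1)) _
      (hev.mono fun t ht p => by rw [ht, mul_comm]; rfl)
      (fun p => analyticAt_monomial hg hf h0 (hnonneg p (v + 2) (by omega)) (hpos p v v.2))
    refine ⟨m1, m2, 1, (h 0).2, _, hd, Or.inr ⟨rfl, ?_⟩, fun p => by simpa using m3 p⟩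
    exact hev.self_of_nhds.trans (congrArg _ (Prod.ext h0 rfl))

/-! ### Smooth branches with independent tangents -/

/-- Finitely many analytic branches with linearly independent tangent vectors form an ordinary
tuple: the sum of the parametrizations maps the coordinate axes to the branches, and it is
inverted by a linear projection followed by a local inverse. -/
theorem isOrdinaryTuple_of_linearIndependent {V ι : Type*} [NormedAddCommGroup V] [NormedSpace ℂ V]
    [FiniteDimensional ℂ V] [Fintype ι] {r : ℕ} (e : ι ≃ Fin r) (φ : ι → ℂ → V)
    (hφ : ∀ i, AnalyticAt ℂ (φ i) 0) (hφ0 : ∀ i, φ i 0 = 0)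
    (hli : LinearIndependent ℂ fun i => deriv (φ i) 0) :
    ∀ᶠ ε : ℝ in 𝓝[>] 0, IsOrdinaryTuple r (⋃ i, φ i '' Metric.ball (0 : ℂ) ε) 0 := by
  classical
  -- a linear projection adapted to the tangent vectors
  obtain ⟨L, hL⟩ : ∃ L : V →ₗ[ℂ] (Fin r → ℂ), ∀ i, L (deriv (φ i) 0) = Pi.single (e i) 1 := by
    obtain ⟨L, hL⟩ := LinearMap.exists_extend
      ((Module.Basis.span hli).constr ℂ (fun i => (Pi.single (e i) 1 : Fin r → ℂ)))
    refine ⟨L, fun i => ?_⟩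
    have h1 := LinearMap.congr_fun hL (Module.Basis.span hli i)
    rw [Module.Basis.constr_basis] at h1
    rw [← h1]
    simp [Module.Basis.span_apply]
  let L' : V →L[ℂ] (Fin r → ℂ) := LinearMap.toContinuousLinearMap L
  let g : (Fin r → ℂ) → V := fun y => ∑ i, φ i (y (e i))
  have hg0 : g 0 = 0 := by simp [g, hφ0]
  have hga : AnalyticAt ℂ g 0 := by
    refine Finset.analyticAt_fun_sum _ fun i _ => ?_
    exact (hφ i).comp_of_eq ((ContinuousLinearMap.proj (R := ℂ) (φ := fun _ : Fin r => ℂ)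
      (e i)).analyticAt 0) rfl
  have hgs : ∀ i t, g (Pi.single (e i) t) = φ i t := by
    intro i t
    simp only [g]
    rw [Finset.sum_eq_single i]
    · simp
    · intro j _ hj
      rw [Pi.single_eq_of_ne (by simpa using hj), hφ0]
    · simp
  have hga' : AnalyticAt ℂ (fun y => L' (g y)) 0 := (L'.analyticAt _).comp hga
  have hderiv : HasStrictFDerivAt (fun y => L' (g y))
      ((ContinuousLinearEquiv.refl ℂ (Fin r → ℂ) : (Fin r → ℂ) →L[ℂ] (Fin r → ℂ))) 0 := by
    have h1 : HasStrictFDerivAt g (∑ i, (ContinuousLinearMap.toSpanSingleton ℂ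
        (deriv (φ i) 0)).comp (ContinuousLinearMap.proj (R := ℂ) (φ := fun _ : Fin r => ℂ)
          (e i))) 0 := by
      refine HasStrictFDerivAt.fun_sum fun i _ => ?_
      exact HasStrictFDerivAt.comp (0 : Fin r → ℂ) (g := φ i)
        (hφ i).hasStrictDerivAt.hasStrictFDerivAt
        (ContinuousLinearMap.proj (R := ℂ) (φ := fun _ : Fin r => ℂ) (e i)).hasStrictFDerivAt
    have h2 := L'.hasStrictFDerivAt.comp (0 : Fin r → ℂ) h1
    refine h2.congr_fderiv ?_
    ext y j
    simp only [L', ContinuousLinearMap.comp_apply, _root_.sum_apply, map_sum,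
      ContinuousLinearMap.toSpanSingleton_apply, map_smul, Finset.sum_apply,
      LinearMap.coe_toContinuousLinearMap', hL]
    rw [← e.symm.sum_comp]
    simp [Pi.single_apply]
  let ψ := hderiv.localInverse
  have hL0 : L' (g 0) = 0 := by rw [hg0, map_zero]
  have hψ : AnalyticAt ℂ ψ 0 := by
    have := (hderiv.toOpenPartialHomeomorph _).analyticAt_symm'
      hderiv.mem_toOpenPartialHomeomorph_source hga' hderiv.hasFDerivAt.fderiv
    rw [HasStrictFDerivAt.toOpenPartialHomeomorph_coe, hL0] at this
    exact this
  let f : V → (Fin r → ℂ) := fun x => ψ (L' x)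
  have hleft : ∀ᶠ y in 𝓝 0, f (g y) = y := hderiv.eventually_left_inverse
  have hf0 : f 0 = 0 := by simpa only [hg0] using hleft.self_of_nhds
  obtain ⟨ρ, hρ, hball⟩ := Metric.eventually_nhds_iff_ball.1 hleft
  have hcurve : ∀ i t, t ∈ Metric.ball (0 : ℂ) ρ → f (φ i t) = Pi.single (e i) t := by
    intro i t ht
    rw [← hgs]
    apply hball
    rw [mem_ball_zero_iff] at ht ⊢
    rwa [Pi.norm_single]
  filter_upwards [Ioo_mem_nhdsGT hρ] with ε hε
  refine ⟨f, g, ?_, hga, hf0, hg0, ?_, ?_⟩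
  · exact AnalyticAt.comp_of_eq hψ (L'.analyticAt 0) (map_zero L')
  · filter_upwards [self_mem_nhdsWithin] with x hx
    obtain ⟨i, t, ht, rfl⟩ := Set.mem_iUnion.1 hx
    rw [hcurve i t (Metric.ball_subset_ball hε.2.le ht), hgs]
    exact ⟨⟨e i, fun j hj => Pi.single_eq_of_ne hj _⟩, rfl⟩
  · filter_upwards [self_mem_nhdsWithin, mem_nhdsWithin_of_mem_nhds hleft,
      mem_nhdsWithin_of_mem_nhds (Metric.ball_mem_nhds 0 hε.1)] with y hy hfy hyε
    refine ⟨?_, hfy⟩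
    obtain ⟨j, hj⟩ := hy
    have hy' : y = Pi.single (e (e.symm j)) (y j) := by
      ext l
      rw [Equiv.apply_symm_apply]
      by_cases h : l = j
      · subst h; simp
      · rw [hj l h, Pi.single_eq_of_ne h]
    rw [hy', hgs]
    refine Set.mem_iUnion.2 ⟨e.symm j, y j, ?_, rfl⟩
    rw [mem_ball_zero_iff] at hyε ⊢
    exact (norm_le_pi_norm y j).trans_lt hyε

/-! ### The relations given by the generators -/

/-- A multiplicity system with `m_v = 1` has nonnegative ends as soon as its neighbouring
entries `m_{v-1}` and `m_{v+1} = k_v - m_{v-1}` are nonnegative, and positive unless they are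
themselves ends. -/
theorem IsMultSeq.ends_nonneg {s : ℕ} {k : Fin s → ℕ} (hk : ∀ v, 2 ≤ k v) {m : ℕ → ℤ}
    (hm : IsMultSeq k m) (v : Fin s) (h1 : m (v + 1) = 1)
    (hlo : if v.val = 0 then 0 ≤ m v else 1 ≤ m v)
    (hhi : if v.val + 1 = s then m v ≤ k v else m v + 1 ≤ k v) :
    0 ≤ m 0 ∧ 0 ≤ m (s + 1) := by
  have hv := hm v
  rw [h1, mul_one] at hv
  constructor
  · split_ifs at hlo with h
    · rwa [h] at hlo
    · exact (hm.grow_left hk (e := 0) le_rfl le_rfl v.2.le (by omega) (by omega)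
        (Nat.zero_le _)).1
  · split_ifs at hhi with h
    · rw [show s + 1 = v.val + 2 by omega, hv]
      omega
    · exact (hm.grow_right hk (e := 0) le_rfl le_rfl (v := v + 1)
        (by rw [show v.val + 1 + 1 = v + 2 from rfl]; omega)
        (by rw [show v.val + 1 + 1 = v + 2 from rfl]; omega) (w := s) v.2 le_rfl).1

/-- The generators of multiplicity one on `E_v` form a chain, whose last member is the first one
of the chain of the next curve.  Hence relations indexed by all generators can be solved by
elimination along the string. -/
theorem eq_zero_of_generator_relations {s : ℕ} {k : Fin s → ℕ} (hk : ∀ v, 2 ≤ k v)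
    (F : ℕ → ℕ → ℂ) (lo H r : ℕ → ℕ) (Z : ℕ → Prop)
    (hlo : ∀ v, lo v = if v = 0 then 0 else 1)
    (hH : ∀ v : Fin s, H v = if v.val + 1 = s then k v else k v - 1)
    (hrel : ∀ m, IsMultSeq k m → 0 ≤ m 0 → 0 ≤ m (s + 1) → (∃ v < s, m (v + 1) = 1) →
      ∑ u ∈ Finset.range s, (if m (u + 1) = 1 then F u (m u).toNat else 0) = 0)
    (hZ : ∀ v < s, ∀ a b, lo v ≤ a → b ≤ H v + 1 → a + r v ≤ b → (v = 0 → a = lo v) →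
      (v + 1 = s → b = H v + 1) → (∀ x, a ≤ x → x < b → F v x = 0) → Z v)
    (hF : ∀ v < s, Z v → ∀ x, F v x = 0)
    (hr : ∀ v₁ w, v₁ < w → w ≤ s →
      ∑ v ∈ Finset.Ico v₁ w, (r v : ℤ) ≤ 1 + ∑ v ∈ Finset.Ico v₁ w, ((H v : ℤ) - lo v)) :
    ∀ v < s, Z v := by
  have hends : ∀ m, IsMultSeq k m → ∀ (v : ℕ), v < s → ∀ x : ℕ, lo v ≤ x → x ≤ H v →
      m v = x → m (v + 1) = 1 → 0 ≤ m 0 ∧ 0 ≤ m (s + 1) := by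
    intro m hm v hv x hx1 hx2 h1 h2
    have hHv := hH ⟨v, hv⟩
    have hkv := hk ⟨v, hv⟩
    have hlov := hlo v
    refine hm.ends_nonneg hk ⟨v, hv⟩ h2 ?_ ?_
    · simp only
      split_ifs at hlov ⊢ <;> omega
    · simp only at hHv ⊢
      split_ifs at hHv ⊢ <;> omega
  -- `M v` is the system of the last generator of the chain of `v`
  choose M hM hMv hMv1 using fun v : Fin s => IsMultSeq.exists_of_eq k v.2.le (H v) 1
  -- the contribution of the first `w` curves to the relation of `m`, and the part of it that is
  -- carried over from the curves before `w` to the curve `w`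
  let P : ℕ → (ℕ → ℤ) → ℂ := fun w m =>
    ∑ u ∈ Finset.range w, (if m (u + 1) = 1 then F u (m u).toNat else 0)
  let T : ℕ → ℂ := fun w => if h : 0 < w ∧ w ≤ s then P w (M ⟨w - 1, by omega⟩) else 0
  have hT0 : T 0 = 0 := by simp [T]
  have hTs : ∀ v : Fin s, T (v + 1) = P (v + 1) (M v) := fun v => by
    simp only [T]
    rw [dif_pos ⟨by omega, by omega⟩]
    rfl
  have hlow : ∀ v < s, lo v ≤ H v := by
    intro v hv
    have hHv := hH ⟨v, hv⟩
    have hkv := hk ⟨v, hv⟩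
    have hlov := hlo v
    simp only at hHv
    split_ifs at hHv hlov <;> omega
  -- the curves before `v` contribute to the members of the chain of `v` only at the shared first one
  have claim : ∀ v < s, ∀ x, lo v ≤ x → ∀ m, IsMultSeq k m → m v = (x : ℤ) →
      m (v + 1) = 1 → P (v + 1) m = F v x + if x = lo v then T v else 0 := by
    intro v hv x hx m hm h1 h2
    simp only [P]
    rw [Finset.sum_range_succ, if_pos h2, h1, Int.toNat_natCast, add_comm]
    congr 1
    rcases v with _ | v
    · simp [hT0]
    · have hlov : lo (v + 1) = 1 := by simp [hlo]
      by_cases hx1 : x = lo (v + 1)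
      · -- the first generator of a chain is the last one of the preceding chain
        rw [if_pos hx1, hTs ⟨v, by omega⟩]
        have hrec := hm ⟨v, by omega⟩
        have hHv := hH ⟨v, by omega⟩
        have hkv := hk ⟨v, by omega⟩
        have hMv' := hMv ⟨v, by omega⟩
        have hMv1' := hMv1 ⟨v, by omega⟩
        simp only at hrec hHv hMv' hMv1'
        rw [if_neg (by omega)] at hHv
        rw [show v + 2 = v + 1 + 1 from rfl, h2, h1, hx1, hlov] at hrec
        have heq : ∀ w ≤ v + 1, m w = M ⟨v, by omega⟩ w := fun w hw =>
          hm.eq_left (hM _) (v := v) (by omega) (by push_cast at hrec; omega)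
            (by rw [h1, hMv1', hx1, hlov]; rfl) hw
        refine Finset.sum_congr rfl fun u hu => ?_
        have : u < v + 1 := Finset.mem_range.1 hu
        rw [heq u (by omega), heq (u + 1) (by omega)]
      · rw [if_neg hx1]
        refine Finset.sum_eq_zero fun u hu => if_neg ?_
        have := Finset.mem_range.1 hu
        have := (hm.grow_left hk (e := 0) (c := 2) le_rfl (by norm_num) (v := v + 1) hv.le
          (by omega) (by omega) (w := u + 1) (by omega)).1
        omega
  -- the curves after `v` contribute only where `m_{v+1} = 1`, that is, to the last member
  have hfull : ∀ v < s, ∀ x, lo v ≤ x → x ≤ H v → ∀ m, IsMultSeq k m → m v = (x : ℤ) →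
      m (v + 1) = 1 → (v + 1 < s → 2 ≤ m (v + 2)) → P (v + 1) m = 0 := by
    intro v hv x hx hxH m hm h1 h2 h3
    obtain ⟨e0, es⟩ := hends m hm v hv x hx hxH h1 h2
    rw [← hrel m hm e0 es ⟨v, hv, h2⟩]
    refine Finset.sum_subset (Finset.range_subset_range.2 hv) fun u hu hu' => if_neg ?_
    rw [Finset.mem_range] at hu hu'
    have h4 := h3 (by omega)
    have := (hm.grow_right hk (e := 0) (c := 2) le_rfl (by norm_num) (v := v + 1) h4
      (by rw [show v + 1 + 1 = v + 2 from rfl]; omega) (w := u) (by omega) hu.le).1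
    omega
  refine (elimination F lo H r T Z hlow hZ hF hT0 ?_ ?_ hr s le_rfl 0 zero_le_one
    (fun _ => rfl) ?_ ?_).2
  · intro v hv x hx hxH
    obtain ⟨m, hm, h1, h2⟩ := IsMultSeq.exists_of_eq k hv.le (x : ℤ) 1
    rw [← claim v hv x hx m hm h1 h2]
    refine hfull v hv x hx hxH.le m hm h1 h2 fun hvs => ?_
    have hrec := hm ⟨v, hv⟩
    have hHv := hH ⟨v, hv⟩
    simp only at hrec hHv
    rw [if_neg (by omega)] at hHv
    rw [hrec, h1, h2]
    omega
  · intro v hv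
    exact (claim v hv (H v) (hlow v hv) _ (hM ⟨v, hv⟩) (hMv ⟨v, hv⟩) (hMv1 ⟨v, hv⟩)).symm.trans
      (hTs ⟨v, hv⟩).symm
  · rintro -
    rcases s with _ | s
    · exact hT0
    · have := hTs ⟨s, by omega⟩
      simp only at this
      rw [this]
      exact hfull s (by omega) (H s) (hlow s (by omega)) le_rfl _ (hM _) (hMv ⟨s, by omega⟩)
        (hMv1 ⟨s, by omega⟩) (by omega)
  · simpa using fun v₁ h => hr v₁ s h le_rfl

theorem valency_eq {s : ℕ} (v : Fin s) :
    valency v = (if v.val = 0 then 0 else 1) + (if v.val + 1 = s then 0 else 1) := by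
  rw [valency, Finset.filter_or, Finset.card_union_of_disjoint]
  · congr 1
    · split_ifs with h
      · rw [Finset.card_eq_zero, Finset.filter_eq_empty_iff]
        intro w _
        omega
      · rw [Finset.card_eq_one]
        refine ⟨⟨v - 1, by omega⟩, ?_⟩
        ext w
        simp only [Finset.mem_filter, Finset.mem_univ, true_and, Finset.mem_singleton, Fin.ext_iff]
        omega
    · split_ifs with h
      · rw [Finset.card_eq_zero, Finset.filter_eq_empty_iff]
        intro w _
        omega
      · rw [Finset.card_eq_one]
        refine ⟨⟨v + 1, by omega⟩, ?_⟩
        ext w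
        simp only [Finset.mem_filter, Finset.mem_univ, true_and, Finset.mem_singleton, Fin.ext_iff]
        omega
  · rw [Finset.disjoint_filter]
    intro w _
    omega

theorem sum_Icc_eq_sum_Ico {s : ℕ} (f : Fin s → ℤ) (g : ℕ → ℤ) (hfg : ∀ v, f v = g v)
    (v₁ v₂ : Fin s) : ∑ v ∈ Finset.Icc v₁ v₂, f v = ∑ v ∈ Finset.Ico v₁.val (v₂ + 1), g v := by
  have h : Finset.Ico v₁.val (v₂ + 1) = (Finset.Icc v₁ v₂).map Fin.valEmbedding := by
    rw [Fin.map_valEmbedding_Icc]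
    rfl
  rw [h, Finset.sum_map]
  exact Finset.sum_congr rfl fun v _ => hfg v

theorem linearIndependent_tangents {n q : ℕ} (hq : 0 < q) (hqn : q < n)
    (hcop : Nat.Coprime n q) {s : ℕ} {k : Fin s → ℕ} (hk : ∀ v, 2 ≤ k v)
    (hnq : hjValue (List.ofFn k) = (n : ℚ) / (q : ℚ))
    {r : Fin s → ℕ} {γ : (v : Fin s) → Fin (r v) → ℂ → Resolution k}
    (hγ : ∀ v i, IsTransversalDisc k v (γ v i))
    (hdiff : ∀ v, Function.Injective fun i => γ v i 0)
    (hr : ∀ v₁ v₂ : Fin s, v₁ ≤ v₂ →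
      ∑ v ∈ Finset.Icc v₁ v₂, (r v : ℤ) ≤
        1 + ∑ v ∈ Finset.Icc v₁ v₂, ((k v : ℤ) - (valency v : ℤ))) :
    LinearIndependent ℂ (fun x : (v : Fin s) × Fin (r v) =>
        deriv (fun t => canonicalMap n q k (γ x.1 x.2 t)) 0) := by
  choose A B c hc hAB hD using fun v i => ((hγ v i).tangent hq hqn hcop hk hnq).2.2
  rw [Fintype.linearIndependent_iff]
  intro g hg
  -- the contribution of a curve `v` at a generator with `m_v = 1` and `m_{v-1} = x`
  let F' : (v : Fin s) → ℕ → ℂ := fun v x =>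
    ∑ i, (g ⟨v, i⟩ * c v i) * (A v i ^ x * B v i ^ (k v - x))
  let F : ℕ → ℕ → ℂ := fun v x => if h : v < s then F' ⟨v, h⟩ x else 0
  have hFF : ∀ (v : Fin s) x, F v x = F' v x := fun v x => by simp [F]
  let Z : ℕ → Prop := fun v => ∀ h : v < s, ∀ i, g ⟨⟨v, h⟩, i⟩ = 0
  let lo : ℕ → ℕ := fun v => if v = 0 then 0 else 1
  let H : ℕ → ℕ := fun v => if h : v < s then (if v + 1 = s then k ⟨v, h⟩ else k ⟨v, h⟩ - 1) else 0
  let r' : ℕ → ℕ := fun v => if h : v < s then r ⟨v, h⟩ else 0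
  have hH : ∀ v : Fin s, H v = if v.val + 1 = s then k v else k v - 1 := fun v => by simp [H]
  suffices hZ : ∀ v < s, Z v from fun x => hZ x.1 x.1.2 x.1.2 x.2
  refine eq_zero_of_generator_relations hk F lo H r' Z (fun _ => rfl) hH ?_ ?_ ?_ ?_
  · intro m hm h0 hs ⟨v, hv, h1⟩
    obtain ⟨p, hp, hpm⟩ := hm.exists_generator hq hqn hcop hk hnq h0 hs hv h1
    have hp' := (mem_generators (hq.trans hqn) _).1 hp
    have hrel := congrFun hg ⟨p, hp⟩
    rw [← Finset.univ_sigma_univ, Finset.sum_sigma] at hrel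
    rw [← Fin.sum_univ_eq_sum_range (fun u => if m (u + 1) = 1 then F u (m u).toNat else 0)]
    simp only [Finset.sum_apply, Pi.smul_apply, smul_eq_mul, Pi.zero_apply] at hrel
    refine Eq.trans (Finset.sum_congr rfl fun u _ => ?_) hrel
    rw [hFF]
    simp only [hD]
    rw [hpm u (by omega), hpm (u + 1) (by omega), hpm (u + 2) (by omega)]
    split_ifs with hu
    · refine Finset.sum_congr rfl fun i _ => ?_
      have hrec := hm u
      rw [hu, mul_one] at hrec
      have e1 : 0 ≤ m u := by
        rcases Nat.eq_zero_or_pos u.val with h | h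
        · rwa [h]
        · have := mult_pos hq hqn hcop hk hnq hp'.1 hp'.2.1 (u - 1) (by omega)
          rw [Nat.sub_add_cancel h, hpm u (by omega)] at this
          exact this.le
      have e2 : 0 ≤ m (u + 2) := by
        rcases eq_or_ne (u.val + 1) s with h | h
        · rwa [show u.val + 2 = s + 1 by omega]
        · have := mult_pos hq hqn hcop hk hnq hp'.1 hp'.2.1 (u + 1) (by omega)
          rw [hpm (u + 1 + 1) (by omega)] at this
          exact this.le
      obtain ⟨x, hx⟩ := Int.eq_ofNat_of_zero_le e1
      have hy : m (u + 2) = ((k u - x : ℕ) : ℤ) := by omega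
      rw [hy, hx, Int.toNat_natCast, zpow_natCast, zpow_natCast]
      ring
    · simp
  · intro v hv a b ha hb hab hfirst hlast hzero _ i
    have hr' : r' v = r ⟨v, hv⟩ := by simp [r', hv]
    have hHv := hH ⟨v, hv⟩
    have hkv := hk ⟨v, hv⟩
    simp only at hHv
    have hcenter := fun i => (hγ ⟨v, hv⟩ i).center_notMem
    have hbk : b ≤ k ⟨v, hv⟩ + 1 := by split_ifs at hHv <;> omega
    have hzero' := eq_zero_of_window (N := b - a) (K := k ⟨v, hv⟩) (a := a) (by omega) (by omega)
      (A ⟨v, hv⟩) (B ⟨v, hv⟩) (fun i => g ⟨⟨v, hv⟩, i⟩ * c ⟨v, hv⟩ i)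
      (fun i => ?_)
      (fun i j hij heq => hij (hdiff _ ((hAB ⟨v, hv⟩ i).eq_of_mul_eq (hAB ⟨v, hv⟩ j) heq)))
      (fun ha i => (hAB ⟨v, hv⟩ i).left_ne_zero (hcenter i) fun h => ?_)
      (fun hne i => (hAB ⟨v, hv⟩ i).right_ne_zero (hcenter i) fun h => ?_)
      (fun x h1 h2 => (hFF ⟨v, hv⟩ x).symm.trans (hzero x h1 (by omega)))
    · exact (mul_eq_zero.1 (congrFun hzero' i)).resolve_right (hc _ _)
    · rcases hAB ⟨v, hv⟩ i with h | h <;> simp [h.1]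
    · have := hfirst h
      have hlov : lo v = 0 := if_pos h
      omega
    · have := hlast h
      simp only at h
      rw [if_pos h] at hHv
      omega
  · intro v hv hZ x
    rw [show F v x = F' ⟨v, hv⟩ x from hFF ⟨v, hv⟩ x]
    exact Finset.sum_eq_zero fun i _ => by rw [hZ hv i]; ring
  · intro v₁ w h1 h2
    have := hr ⟨v₁, by omega⟩ ⟨w - 1, by omega⟩ (Fin.mk_le_mk.2 (by omega))
    rw [sum_Icc_eq_sum_Ico _ (fun v => (r' v : ℤ)) (fun v => by simp [r']),
      sum_Icc_eq_sum_Ico _ (fun v => (H v : ℤ) - lo v) (fun v => ?_)] at this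
    · simpa only [Nat.sub_add_cancel (show 1 ≤ w by omega)] using this
    · have hkv := hk v
      rw [hH, valency_eq]
      simp only [lo]
      split_ifs <;> push_cast <;> omega

end CyclicQuotient

theorem mainTheorem1 (n q : ℕ) (hq : 0 < q) (hqn : q < n) (hcop : Nat.Coprime n q)
    {s : ℕ} (k : Fin s → ℕ) (hk : ∀ v, 2 ≤ k v)
    (hnq : CyclicQuotient.hjValue (List.ofFn k) = (n : ℚ) / (q : ℚ))
    (r : Fin s → ℕ) (γ : (v : Fin s) → Fin (r v) → ℂ → CyclicQuotient.Resolution k)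
    (hγ : ∀ v i, CyclicQuotient.IsTransversalDisc k v (γ v i))
    (hdiff : ∀ v, Function.Injective fun i => γ v i 0)
    (hr : ∀ v₁ v₂ : Fin s, v₁ ≤ v₂ →
      ∑ v ∈ Finset.Icc v₁ v₂, (r v : ℤ) ≤
        1 + ∑ v ∈ Finset.Icc v₁ v₂, ((k v : ℤ) - (CyclicQuotient.valency v : ℤ))) :
    LinearIndependent ℂ (fun x : (v : Fin s) × Fin (r v) =>
        deriv (fun t => CyclicQuotient.canonicalMap n q k (γ x.1 x.2 t)) 0) ∧
      ∀ᶠ ε : ℝ in 𝓝[>] 0,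
        CyclicQuotient.IsOrdinaryTuple (∑ v, r v)
          (⋃ x : (v : Fin s) × Fin (r v),
            (fun t => CyclicQuotient.canonicalMap n q k (γ x.1 x.2 t)) '' Metric.ball (0 : ℂ) ε)
          0 := by
  have hli := CyclicQuotient.linearIndependent_tangents hq hqn hcop hk hnq hγ hdiff hr
  have hdisc := fun x : (v : Fin s) × Fin (r v) =>
    (hγ x.1 x.2).tangent hq hqn hcop hk hnq
  exact ⟨hli, CyclicQuotient.isOrdinaryTuple_of_linearIndependent finSigmaFinEquiv _
    (fun x => (hdisc x).1) (fun x => (hdisc x).2.1) hli⟩
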